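/- Let $R$ be a nonzero commutative ring with identity. The following are equivalent. (1) $R$ is von Neumann regular (that is, reduced of Krull dimension $0$). (2) $R[X]$ is a Bézout ring (every finitely generated ideal is principal). (3) $R[X]$ is arithmetical (for each maximal ideal $M$, the ideals of $R[X]_M$ form a chain under inclusion). (4) $R[X]$ satisfies $(*)$: each ideal of $R[X]$ whose radical is prime is a primary ideal. (5) $R[X]_M$ is a DVR (a Noetherian valuation domain that is not a field) for each maximal ideal $M$ of $R[X]$. (6) $R[X]_M$ is a Mori PVD for each maximal ideal $M$ of $R[X]$. (7) $R[X]_M$ is a PVD for each maximal ideal $M$ of $R[X]$. (8) $R[X]$ is an LPVR. (9) $R[X]_M$ is a TAF-domain for each maximal ideal $M$ of $R[X]$. (10) $R[X]_M$ is a TAF-ring for each maximal ideal $M$ of $R[X]$. (11) $R[X]_M$ is an FAF-ring for each maximal ideal $M$ of $R[X]$. (12) $R[X]_M$ is a one-dimensional domain for each maximal ideal $M$ of $R[X]$. (13) $R[X]$ is locally divided. (14) $R[X]$ is a one-dimensional reduced ring. Here "one-dimensional" means of Krull dimension $1$, and the following definitions are used for a commutative ring $A$. If $A$ is a domain with quotient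 field $K$, then $A$ is a PVD (pseudo-valuation domain) if for every prime ideal $P$ of $A$ and all $x,y\in K$ with $xy\in P$, either $x\in P$ or $y\in P$; for $A$-submodules $I,J$ of $K$ put $I:J=\{x\in K\mid xJ\subseteq I\}$, call a nonzero ideal $I$ of $A$ divisorial if $A:(A:I)=I$, and call $A$ a Mori domain if it satisfies the ascending chain condition on divisorial ideals. A prime ideal $P$ of $A$ is strongly prime if $aP$ and $bA$ are comparable under inclusion for all $a,b\in A$; $A$ is a PVR (pseudo-valuation ring) if some maximal ideal of $A$ is strongly prime, and an LPVR if $A_M$ is a PVR for each maximal ideal $M$. For an integer $n\ge 1$, a proper ideal $I$ of $A$ is $n$-absorbing if whenever $a_1\cdots a_{n+1}\in I$ with $a_1,\dots,a_{n+1}\in A$, there is an $i$ with $\prod_{j\neq i}a_j\in I$. The ring $A$ is a TAF-ring if every proper ideal is a finite product of $2$-absorbing ideals, a TAF-domain if it is moreover an integral domain, and an FAF-ring if there is an $n\ge 1$ such that every proper ideal of $A$ is a finite product of $n$-absorbing ideals. The ring $A$ is divided if $P\subsetneq aA$ for every prime ideal $P$ of $A$ and every $a\in A\setminus P$, and locally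 divided if $A_M$ is divided for each maximal ideal $M$. -/

import Mathlib

open Polynomial

namespace AbsorbingFactorization

section RingClasses

variable (A : Type*) [CommRing A]

/-- von Neumann regular: reduced and of Krull dimension zero. -/
def IsVonNeumannRegular : Prop :=
  IsReduced A ∧ ringKrullDim A = 0

/-- Arithmetical: for each maximal ideal `M`, the ideals of `A_M` form a chain. -/
def IsArithmetical : Prop :=
  ∀ (M : Ideal A) [M.IsMaximal] (I J : Ideal (Localization.AtPrime M)), I ≤ J ∨ J ≤ I

/-- The condition `(*)`: every ideal whose radical is prime is primary. -/
def SatisfiesStar : Prop :=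
  ∀ I : Ideal A, I.radical.IsPrime → I.IsPrimary

/-- Discrete valuation ring, as a predicate that includes being a domain
(fields are excluded). -/
def IsDVR : Prop :=
  ∃ _ : IsDomain A, IsDiscreteValuationRing A

variable {A} in
/-- Strongly prime ideals of an integral domain, tested in the quotient field. -/
def IsStronglyPrimeInFractions (P : Ideal A) : Prop :=
  ∀ x y : FractionRing A,
    x * y ∈ IsLocalization.coeSubmodule (FractionRing A) P →
      x ∈ IsLocalization.coeSubmodule (FractionRing A) P ∨
        y ∈ IsLocalization.coeSubmodule (FractionRing A) P

/-- Pseudo-valuation domain: a domain whose prime ideals are all strongly prime. -/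
def IsPVD : Prop :=
  IsDomain A ∧ ∀ P : Ideal A, P.IsPrime → IsStronglyPrimeInFractions P

variable {A} in
/-- Divisorial (integral) ideal of a domain: a nonzero ideal `I` with `A : (A : I) = I`, where
`I : J` is the set of `x` in the quotient field with `x J ⊆ I`. Here `1` is `A` itself, viewed as
a submodule of its quotient field, and `/` is Mathlib's quotient of submodules. -/
def IsDivisorial (I : Ideal A) : Prop :=
  I ≠ ⊥ ∧
    (1 : Submodule A (FractionRing A)) /
        ((1 : Submodule A (FractionRing A)) / IsLocalization.coeSubmodule (FractionRing A) I) =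
      IsLocalization.coeSubmodule (FractionRing A) I

/-- Mori domain: a domain with the ascending chain condition on divisorial ideals. -/
def IsMori : Prop :=
  IsDomain A ∧
    ∀ f : ℕ →o Ideal A, (∀ k, IsDivisorial (f k)) → ∃ n, ∀ m, n ≤ m → f n = f m

variable {A} in
/-- Strongly prime ideals of an arbitrary commutative ring: a prime `P` such that `aP` and `bA`
are comparable for all `a`, `b`. -/
def IsStronglyPrime (P : Ideal A) : Prop :=
  P.IsPrime ∧
    ∀ a b : A, Ideal.span {a} * P ≤ Ideal.span {b} ∨ Ideal.span {b} ≤ Ideal.span {a} * P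

/-- Pseudo-valuation ring: some maximal ideal is strongly prime. -/
def IsPVR : Prop :=
  ∃ M : Ideal A, M.IsMaximal ∧ IsStronglyPrime M

/-- Locally pseudo-valuation ring. -/
def IsLPVR : Prop :=
  ∀ (M : Ideal A) [M.IsMaximal], IsPVR (Localization.AtPrime M)

variable {A} in
/-- `n`-absorbing (proper) ideals: whenever a product of `n + 1` elements lies in `I`, so does one
of its `n`-element subproducts. -/
def IsNAbsorbing (n : ℕ) (I : Ideal A) : Prop :=
  I ≠ ⊤ ∧ ∀ a : Fin (n + 1) → A, ∏ i, a i ∈ I → ∃ i, ∏ j ∈ Finset.univ.erase i, a j ∈ I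

/-- Every proper ideal is a finite product of `n`-absorbing ideals. -/
def HasAbsorbingFactorization (n : ℕ) : Prop :=
  ∀ I : Ideal A, I ≠ ⊤ → ∃ s : Multiset (Ideal A), (∀ J ∈ s, IsNAbsorbing n J) ∧ s.prod = I

/-- TAF-ring: every proper ideal is a finite product of 2-absorbing ideals. -/
def IsTAFRing : Prop :=
  HasAbsorbingFactorization A 2

/-- FAF-ring: for some positive `n`, every proper ideal is a finite product of `n`-absorbing
ideals. -/
def IsFAFRing : Prop :=
  ∃ n : ℕ, 1 ≤ n ∧ HasAbsorbingFactorization A n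

/-- Divided ring: `P ⊊ aA` for every prime ideal `P` and every `a` outside `P`. -/
def IsDivided : Prop :=
  ∀ P : Ideal A, P.IsPrime → ∀ a : A, a ∉ P → P < Ideal.span {a}

/-- Locally divided ring. -/
def IsLocallyDivided : Prop :=
  ∀ (M : Ideal A) [M.IsMaximal], IsDivided (Localization.AtPrime M)

end RingClasses

end AbsorbingFactorization

/-! `R` is von Neumann regular exactly when `R_p` is a field for every maximal `p`, that is, when
each element of `p` is killed by something outside `p` (`MaximalIdealsVanishLocally`).

Given this, let `M` be maximal in `R[X]` with contraction `p`: then `R[X]_M` is a localization of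
`(R ⧸ p)[X]` at a nonzero prime, hence a DVR, and the other local conditions follow. Bézout comes
from a Euclidean algorithm split by idempotents.

Conversely, compare `X` with a constant `c ∈ p` in `R[X]` localized at `(p, X)`. The extension of `p
R[X]` is a prime containing `c` but no power of `X`, so `c` divides no `X ^ k`; and `X ∣ c` yields
`u ∉ p` with `u * c = 0` (`exists_mul_eq_zero_of_X_dvd`). Chained ideals or dividedness force `X ∣
c` at once. In the FAF case `(c, X ^ (n + 1))` is not `n`-absorbing, so it is a product of two
proper ideals, hence principal by Nakayama, and again `X ∣ c`. Condition `(*)` is tested on `J R[X]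
+ X p R[X]` with `J` of radical `p`; condition (14) descends by `dim R + 1 ≤ dim R[X]`. -/

namespace AbsorbingFactorization

/-! ### Von Neumann regularity as local vanishing -/

section LocalVanishing

variable (R : Type*) [CommRing R]

/-- Every element of a maximal ideal vanishes in the localization at that ideal. -/
def MaximalIdealsVanishLocally : Prop :=
  ∀ p : Ideal R, p.IsMaximal → ∀ a ∈ p, ∃ u ∉ p, u * a = 0

variable {R}

/-- In dimension zero `p` is minimal, so its elements are nilpotent in `R_p`: `u * a ^ n = 0` with
`u ∉ p`. Then `u * a` is nilpotent, hence zero. -/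
theorem IsVonNeumannRegular.maximalIdealsVanishLocally [Nontrivial R]
    (h : IsVonNeumannRegular R) : MaximalIdealsVanishLocally R := by
  obtain ⟨hred, hdim⟩ := h
  have := ringKrullDimZero_iff_ringKrullDim_eq_zero.mpr hdim
  intro p hp a ha
  have hrad := IsLocalization.AtPrime.radical_map_of_mem_minimalPrimes (Localization.AtPrime p) p ⊥
    (Ideal.mem_minimalPrimes_of_krullDimLE_zero p)
  have ha' : algebraMap R (Localization.AtPrime p) a ∈ p.map (algebraMap R _) :=
    Ideal.mem_map_of_mem _ ha
  rw [← hrad, Ideal.map_bot] at ha'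
  obtain ⟨n, hn⟩ := ha'
  rw [← map_pow, Ideal.mem_bot, IsLocalization.map_eq_zero_iff p.primeCompl] at hn
  obtain ⟨u, hu⟩ := hn
  refine ⟨u, u.2, ?_⟩
  have : IsNilpotent ((u : R) * a) := ⟨n + 1, by
    rw [mul_pow, pow_succ, pow_succ]
    linear_combination (u : R) ^ n * a * hu⟩
  exact this.eq_zero

theorem MaximalIdealsVanishLocally.isReduced (h : MaximalIdealsVanishLocally R) :
    IsReduced R := by
  refine ⟨fun x hx ↦ ?_⟩
  by_contra hx0
  have hne : (LinearMap.toSpanSingleton R R x).ker ≠ ⊤ := fun htop ↦ hx0 <| by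
    have : (1 : R) ∈ (LinearMap.toSpanSingleton R R x).ker := htop ▸ Submodule.mem_top
    simpa using this
  obtain ⟨p, hp, hle⟩ := Ideal.exists_le_maximal _ hne
  obtain ⟨n, hn⟩ := hx
  obtain ⟨u, hu, hux⟩ := h p hp x (hp.isPrime.mem_of_pow_mem n (hn ▸ p.zero_mem))
  exact hu (hle (by simpa using hux))

theorem MaximalIdealsVanishLocally.isMaximal_of_isPrime (h : MaximalIdealsVanishLocally R)
    (I : Ideal R) (hI : I.IsPrime) : I.IsMaximal := by
  obtain ⟨p, hp, hle⟩ := Ideal.exists_le_maximal I hI.ne_top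
  have : p ≤ I := fun a ha ↦ by
    obtain ⟨u, hu, hua⟩ := h p hp a ha
    exact (hI.mem_or_mem (hua ▸ I.zero_mem)).resolve_left fun h ↦ hu (hle h)
  exact le_antisymm hle this ▸ hp

theorem MaximalIdealsVanishLocally.isVonNeumannRegular [Nontrivial R]
    (h : MaximalIdealsVanishLocally R) : IsVonNeumannRegular R :=
  ⟨h.isReduced, ringKrullDimZero_iff_ringKrullDim_eq_zero.mp
    (Ring.KrullDimLE.mk₀ h.isMaximal_of_isPrime)⟩

/-- No maximal ideal contains both `a` and its annihilator, so `1 = y + b * a` with `y * a = 0`. -/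
theorem MaximalIdealsVanishLocally.exists_eq_mul_mul_self (h : MaximalIdealsVanishLocally R)
    (a : R) : ∃ b, a * a * b = a := by
  have htop : (LinearMap.toSpanSingleton R R a).ker ⊔ Ideal.span {a} = ⊤ := by
    by_contra hne
    obtain ⟨p, hp, hle⟩ := Ideal.exists_le_maximal _ hne
    obtain ⟨u, hu, hua⟩ := h p hp a
      (hle (Ideal.mem_sup_right (Ideal.mem_span_singleton_self a)))
    exact hu (hle (Ideal.mem_sup_left (by simpa using hua)))
  obtain ⟨y, hy, z, hz, hyz⟩ := Submodule.mem_sup.mp (htop ▸ Submodule.mem_top : (1 : R) ∈ _)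
  obtain ⟨b, rfl⟩ := Ideal.mem_span_singleton'.mp hz
  have hy' : y * a = 0 := by simpa using hy
  exact ⟨b, by linear_combination a * hyz - hy'⟩

/-- An element of `p R[X]` vanishes in the localization at `p`. -/
theorem MaximalIdealsVanishLocally.exists_C_mul_eq_zero (h : MaximalIdealsVanishLocally R)
    {p : Ideal R} (hp : p.IsMaximal) {f : R[X]} (hf : f ∈ p.map C) :
    ∃ u ∉ p, C u * f = 0 := by
  rw [Ideal.mem_map_C_iff] at hf
  choose u hu huf using fun n ↦ h p hp _ (hf n)
  refine ⟨∏ n ∈ f.support, u n, fun hmem ↦ ?_, ?_⟩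
  · obtain ⟨n, -, hn⟩ := (hp.isPrime.prod_mem_iff).mp hmem
    exact hu n hn
  · ext n
    rw [coeff_C_mul, coeff_zero]
    by_cases hn : n ∈ f.support
    · rw [← Finset.prod_erase_mul _ _ hn, mul_assoc, huf, mul_zero]
    · rw [notMem_support_iff.mp hn, mul_zero]

end LocalVanishing

/-! ### Bézout and arithmetical rings -/

section Bezout

variable {R : Type*} [CommRing R]

/-- Over a von Neumann regular ring, two polynomials generate a principal ideal: the Euclidean
algorithm, run separately on the two factors cut out by the support idempotent of a leading
coefficient. -/
theorem isPrincipal_span_pair_of_forall_exists_mul_mul_self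
    (h : ∀ a : R, ∃ b, a * a * b = a) (k : ℕ) :
    ∀ (m n : ℕ) (f g : R[X]), m + n = k → f ∈ degreeLT R m → g ∈ degreeLT R n →
      ∃ d : R[X], Ideal.span {f, g} = Ideal.span {d} := by
  induction k using Nat.strong_induction_on with
  | _ k ih =>
  intro m n f g hk hf hg
  wlog hmn : m ≤ n generalizing m n f g
  · rw [Set.pair_comm]
    exact this n m g f (by omega) hg hf (by omega)
  rcases m with _ | m
  · have : f = 0 := by
      ext i
      exact coeff_eq_zero_of_degree_lt ((mem_degreeLT.mp hf).trans_le (by simp))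
    exact ⟨g, by rw [this, Set.pair_comm, ← Ideal.span_insert_zero (s := {g}), Set.pair_comm]⟩
  obtain ⟨l, rfl⟩ : ∃ l, n = m + l + 1 := ⟨n - m - 1, by omega⟩
  have hcoeff : ∀ (q : R[X]) (j : ℕ), q ∈ degreeLT R j ↔ ∀ i, j ≤ i → q.coeff i = 0 := by
    intro q j
    rw [mem_degreeLT, degree_lt_iff_coeff_zero]
  rw [hcoeff] at hf hg
  obtain ⟨b, hb⟩ := h (f.coeff m)
  set a := f.coeff m with ha
  have hid : a * b * (a * b) = a * b := by linear_combination b * hb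
  -- Where the idempotent `a * b` is zero, so is `a`, and the degree bound on `f` drops.
  obtain ⟨d₁, hd₁⟩ := ih (m + (m + l + 1)) (by omega) m (m + l + 1) (C (1 - a * b) * f)
    (C (1 - a * b) * g) rfl
    ((hcoeff _ _).mpr fun i hi ↦ by
      rw [coeff_C_mul]
      rcases hi.eq_or_lt with rfl | hi
      · linear_combination -hb
      · rw [hf i hi, mul_zero])
    ((hcoeff _ _).mpr fun i hi ↦ by rw [coeff_C_mul, hg i hi, mul_zero])
  -- Where `a * b` is one, `a` has inverse `b`, and a division step cancels the top coefficient of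
  -- `g`.
  obtain ⟨d₂, hd₂⟩ := ih (m + 1 + (m + l)) (by omega) (m + 1) (m + l) (C (a * b) * f)
    (C (a * b) * g - C (b * g.coeff (m + l)) * X ^ l * (C (a * b) * f)) rfl
    ((hcoeff _ _).mpr fun i hi ↦ by rw [coeff_C_mul, hf i hi, mul_zero])
    ((hcoeff _ _).mpr fun i hi ↦ by
      have : C (b * g.coeff (m + l)) * X ^ l * (C (a * b) * f) =
          C (b * g.coeff (m + l) * (a * b)) * f * X ^ l := by
        simp only [C_mul]; ring
      rw [this, coeff_sub, coeff_C_mul, coeff_mul_X_pow', if_pos (by omega), coeff_C_mul]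
      rcases hi.eq_or_lt with rfl | hi
      · rw [Nat.add_sub_cancel, ← ha]
        linear_combination -g.coeff (m + l) * hid
      · rw [hg i hi, hf (i - l) (by omega)]
        ring)
  have hE : (C (a * b) * C (a * b) : R[X]) = C (a * b) := by rw [← C_mul, hid]
  set E : R[X] := C (a * b)
  have hE' : (C (1 - a * b) : R[X]) = 1 - E := by rw [C_sub, C_1]
  rw [hE'] at hd₁
  set q := C (b * g.coeff (m + l)) * X ^ l
  have key : ∀ x y d : R[X], Ideal.span {x, y} = Ideal.span {d} →
      (∃ s t, s * x + t * y = d) ∧ (∃ s, s * d = x) ∧ ∃ s, s * d = y := by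
    intro x y d hd
    refine ⟨Ideal.mem_span_pair.mp (hd ▸ Ideal.mem_span_singleton_self d),
      Ideal.mem_span_singleton'.mp (hd ▸ Ideal.subset_span (by simp)),
      Ideal.mem_span_singleton'.mp (hd ▸ Ideal.subset_span (by simp))⟩
  obtain ⟨⟨s₁, t₁, h₁⟩, ⟨u₁, hu₁⟩, v₁, hv₁⟩ := key _ _ _ hd₁
  obtain ⟨⟨s₂, t₂, h₂⟩, ⟨u₂, hu₂⟩, v₂, hv₂⟩ := key _ _ _ hd₂
  -- The two generators live on complementary factors, so their sum generates both parts.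
  have hEd₁ : E * d₁ = 0 := by
    linear_combination -E * h₁ - (s₁ * f + t₁ * g) * hE
  have hEd₂ : E * d₂ = d₂ := by
    linear_combination -(E - 1) * h₂ + (s₂ * f + t₂ * (g - q * f)) * hE
  refine ⟨d₁ + d₂, le_antisymm ?_ ?_⟩
  · rw [Ideal.span_le, Set.insert_subset_iff, Set.singleton_subset_iff]
    constructor
    · refine Ideal.mem_span_singleton'.mpr ⟨(1 - E) * u₁ + E * u₂, ?_⟩
      linear_combination (u₂ - u₁) * hEd₁ + (u₂ - u₁) * hEd₂ + hu₁ + hu₂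
    · refine Ideal.mem_span_singleton'.mpr ⟨(1 - E) * v₁ + E * (v₂ + q * u₂), ?_⟩
      linear_combination (v₂ + q * u₂ - v₁) * hEd₁ + (v₂ + q * u₂ - v₁) * hEd₂ + hv₁ + hv₂ + q * hu₂
  · rw [Ideal.span_singleton_le_iff_mem]
    refine Ideal.mem_span_pair.mpr ⟨s₁ * (1 - E) + s₂ * E - t₂ * q * E,
      t₁ * (1 - E) + t₂ * E, ?_⟩
    linear_combination h₁ + h₂

theorem MaximalIdealsVanishLocally.isBezout_polynomial (h : MaximalIdealsVanishLocally R) :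
    IsBezout R[X] := by
  rw [IsBezout.iff_span_pair_isPrincipal]
  intro f g
  have hmem : ∀ q : R[X], q ∈ degreeLT R (q.natDegree + 1) := fun q ↦ by
    rw [mem_degreeLT, degree_lt_iff_coeff_zero]
    exact fun i hi ↦ coeff_eq_zero_of_natDegree_lt hi
  obtain ⟨d, hd⟩ := isPrincipal_span_pair_of_forall_exists_mul_mul_self
    h.exists_eq_mul_mul_self _ _ _ f g rfl (hmem f) (hmem g)
  exact ⟨d, hd⟩

/-- In a local ring in which every two-generated ideal is principal, divisibility is total. -/
theorem dvd_or_dvd_of_span_pair_eq {A : Type*} [CommRing A] [IsLocalRing A] {x y d : A}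
    (h : Ideal.span {x, y} = Ideal.span {d}) : x ∣ y ∨ y ∣ x := by
  obtain ⟨s, t, hd⟩ := Ideal.mem_span_pair.mp (h ▸ Ideal.mem_span_singleton_self d)
  obtain ⟨u, hu⟩ := Ideal.mem_span_singleton'.mp
    (h ▸ Ideal.subset_span (by simp) : x ∈ Ideal.span {d})
  obtain ⟨v, hv⟩ := Ideal.mem_span_singleton'.mp
    (h ▸ Ideal.subset_span (by simp) : y ∈ Ideal.span {d})
  -- By locality either `u` or `v` is a unit, so `x` or `y` is associated to `d`, or else `d = 0`.
  have hzero : d * (1 - (s * u + t * v)) = 0 := by linear_combination -hd - s * hu - t * hv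
  rcases IsLocalRing.isUnit_or_isUnit_one_sub_self (s * u + t * v) with h | h
  · rcases IsLocalRing.isUnit_or_isUnit_of_isUnit_add h with h | h
    · obtain ⟨w, hw⟩ := (isUnit_of_mul_isUnit_right h).exists_left_inv
      exact Or.inl ⟨v * w, by linear_combination -hv + v * w * hu - v * d * hw⟩
    · obtain ⟨w, hw⟩ := (isUnit_of_mul_isUnit_right h).exists_left_inv
      exact Or.inr ⟨u * w, by linear_combination -hu + u * w * hv - u * d * hw⟩
  · have : d = 0 := h.mul_left_eq_zero.mp hzero
    exact Or.inl ⟨0, by rw [← hv, this]; simp⟩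

theorem isArithmetical_of_isBezout (A : Type*) [CommRing A] [IsBezout A] : IsArithmetical A := by
  intro M hM I J
  have htotal : ∀ x y : Localization.AtPrime M, x ∣ y ∨ y ∣ x := by
    intro x y
    obtain ⟨a, s, rfl⟩ := IsLocalization.exists_mk'_eq M.primeCompl x
    obtain ⟨b, t, rfl⟩ := IsLocalization.exists_mk'_eq M.primeCompl y
    obtain ⟨d, hd⟩ := IsBezout.span_pair_isPrincipal a b
    have := congrArg (Ideal.map (algebraMap A (Localization.AtPrime M))) hd
    rw [Ideal.submodule_span_eq, Ideal.map_span, Ideal.map_span, Set.image_pair,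
      Set.image_singleton] at this
    have hassoc : ∀ (c : A) (r : M.primeCompl),
        Associated (algebraMap A (Localization.AtPrime M) c) (IsLocalization.mk' _ c r) := by
      intro c r
      refine Associated.symm ⟨(IsLocalization.map_units _ r).unit, ?_⟩
      rw [IsUnit.unit_spec, IsLocalization.mk'_spec]
    rw [← (hassoc a s).dvd_iff_dvd_left, ← (hassoc a s).dvd_iff_dvd_right,
      ← (hassoc b t).dvd_iff_dvd_left, ← (hassoc b t).dvd_iff_dvd_right]
    exact dvd_or_dvd_of_span_pair_eq this
  by_contra! hIJ
  obtain ⟨x, hxI, hxJ⟩ := SetLike.not_le_iff_exists.mp hIJ.1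
  obtain ⟨y, hyJ, hyI⟩ := SetLike.not_le_iff_exists.mp hIJ.2
  rcases htotal x y with h | h
  · exact hyI (I.mem_of_dvd h hxI)
  · exact hxJ (J.mem_of_dvd h hyJ)

end Bezout

end AbsorbingFactorization

namespace AbsorbingFactorization

/-! ### Localization at `(p, X)` -/

section OriginLocalization

variable {R : Type*} [CommRing R]

/-- The maximal ideal `(p, X)` of `R[X]` lying over a maximal ideal `p` of `R`. -/
noncomputable def originIdeal (p : Ideal R) : Ideal R[X] :=
  p.comap constantCoeff

theorem mem_originIdeal {p : Ideal R} {f : R[X]} : f ∈ originIdeal p ↔ f.coeff 0 ∈ p :=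
  Iff.rfl

instance originIdeal_isMaximal (p : Ideal R) [p.IsMaximal] : (originIdeal p).IsMaximal :=
  Ideal.comap_isMaximal_of_surjective constantCoeff constantCoeff_surjective

instance isPrime_map_C (p : Ideal R) [p.IsPrime] : (p.map C).IsPrime :=
  Ideal.isPrime_map_C_of_isPrime

theorem X_notMem_map_C {p : Ideal R} (hp : p ≠ ⊤) : (X : R[X]) ∉ p.map C := fun h ↦
  hp <| (Ideal.eq_top_iff_one p).mpr <| by simpa using Ideal.mem_map_C_iff.mp h 1

theorem X_mem_originIdeal (p : Ideal R) : (X : R[X]) ∈ originIdeal p := by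
  simp [mem_originIdeal]

theorem map_C_le_originIdeal (p : Ideal R) : p.map C ≤ originIdeal p :=
  fun _ hf ↦ Ideal.mem_map_C_iff.mp hf 0

variable (p : Ideal R) [p.IsMaximal]

/-- The image of `p R[X]` in the localization at `(p, X)`. -/
noncomputable abbrev extendedPrime : Ideal (Localization.AtPrime (originIdeal p)) :=
  (p.map C).map (algebraMap R[X] _)

theorem disjoint_primeCompl_map_C :
    Disjoint ((originIdeal p).primeCompl : Set R[X]) (p.map C : Ideal R[X]) :=
  Set.disjoint_left.mpr fun _ hf hf' ↦ hf (map_C_le_originIdeal p hf')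

instance extendedPrime_isPrime : (extendedPrime p).IsPrime :=
  IsLocalization.isPrime_of_isPrime_disjoint (originIdeal p).primeCompl _ _ inferInstance
    (disjoint_primeCompl_map_C p)

theorem algebraMap_mem_extendedPrime {f : R[X]} :
    algebraMap R[X] _ f ∈ extendedPrime p ↔ f ∈ p.map C := by
  have := IsLocalization.under_map_of_isPrime_disjoint (originIdeal p).primeCompl
    (Localization.AtPrime (originIdeal p)) (I := p.map C) inferInstance
    (disjoint_primeCompl_map_C p)
  exact SetLike.ext_iff.mp this f

theorem X_notMem_extendedPrime : algebraMap R[X] _ X ∉ extendedPrime p := by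
  rw [algebraMap_mem_extendedPrime]
  exact X_notMem_map_C Ideal.IsPrime.ne_top'

variable {p}

theorem C_mem_extendedPrime {c : R} (hc : c ∈ p) : algebraMap R[X] _ (C c) ∈ extendedPrime p :=
  Ideal.mem_map_of_mem _ (Ideal.mem_map_of_mem _ hc)

/-- A constant divisible by `X` in the localization at `(p, X)` vanishes locally at `p`. -/
theorem exists_mul_eq_zero_of_X_dvd {c : R}
    (h : algebraMap R[X] (Localization.AtPrime (originIdeal p)) X ∣ algebraMap R[X] _ (C c)) :
    ∃ u ∉ p, u * c = 0 := by
  obtain ⟨y, hy⟩ := h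
  obtain ⟨f, s, rfl⟩ := IsLocalization.exists_mk'_eq (originIdeal p).primeCompl y
  rw [← IsLocalization.mk'_one (M := (originIdeal p).primeCompl) _ (X : R[X]),
    ← IsLocalization.mk'_mul, one_mul, eq_comm, IsLocalization.mk'_eq_iff_eq_mul, ← map_mul,
    IsLocalization.eq_iff_exists (originIdeal p).primeCompl] at hy
  obtain ⟨t, ht⟩ := hy
  -- The cleared equation equates `t * s * c` with a multiple of `X`; constant coefficients give the
  -- claim.
  refine ⟨(t * s : R[X]).coeff 0, fun hmem ↦ (t * s).2 (mem_originIdeal.mpr hmem), ?_⟩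
  have := congrArg (coeff · 0) ht
  simp only [mul_coeff_zero, coeff_X_zero, coeff_C_zero] at this ⊢
  linear_combination -this

theorem maximalIdealsVanishLocally_of_isArithmetical (h : IsArithmetical R[X]) :
    MaximalIdealsVanishLocally R := by
  intro p hp c hc
  refine exists_mul_eq_zero_of_X_dvd (p := p) ?_
  rcases h (originIdeal p) (Ideal.span {algebraMap R[X] _ X})
    (Ideal.span {algebraMap R[X] _ (C c)}) with hle | hle
  · refine absurd ?_ (X_notMem_extendedPrime p)
    exact (Ideal.span_singleton_le_iff_mem _).mpr (C_mem_extendedPrime hc)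
      (hle (Ideal.mem_span_singleton_self _))
  · exact Ideal.span_singleton_le_span_singleton.mp hle

theorem maximalIdealsVanishLocally_of_isLocallyDivided (h : IsLocallyDivided R[X]) :
    MaximalIdealsVanishLocally R := by
  intro p hp c hc
  exact exists_mul_eq_zero_of_X_dvd (p := p) <| Ideal.mem_span_singleton.mp <|
    (h (originIdeal p) (extendedPrime p) inferInstance _ (X_notMem_extendedPrime p)).le
      (C_mem_extendedPrime hc)

end OriginLocalization

/-! ### Dimension one -/

section OneDimensional

variable {R : Type*} [CommRing R]

theorem algebraMap_eq_zero_of_mem_of_ringKrullDim_eq_one {A : Type*} [CommRing A] {M P : Ideal A}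
    [M.IsMaximal] [IsDomain (Localization.AtPrime M)]
    (hdim : ringKrullDim (Localization.AtPrime M) = 1) (hP : P.IsPrime) (hPM : P < M) {x : A}
    (hx : x ∈ P) : algebraMap A (Localization.AtPrime M) x = 0 := by
  have : Ring.KrullDimLE 1 (Localization.AtPrime M) := Order.krullDimLE_iff .. |>.mpr hdim.le
  have hdisj : Disjoint (M.primeCompl : Set A) P :=
    Set.disjoint_left.mpr fun _ hf hf' ↦ hf (hPM.le hf')
  have hprime := IsLocalization.isPrime_of_isPrime_disjoint M.primeCompl (Localization.AtPrime M)
    P hP hdisj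
  have hunder := IsLocalization.under_map_of_isPrime_disjoint M.primeCompl
    (Localization.AtPrime M) hP hdisj
  by_contra hx0
  have hmem : algebraMap A (Localization.AtPrime M) x ∈ P.map (algebraMap A _) :=
    Ideal.mem_map_of_mem _ hx
  have hmax := hprime.isMaximal_of_ne_bot fun hbot ↦ hx0 (by simpa [hbot] using hmem)
  rw [IsLocalRing.eq_maximalIdeal hmax, Localization.AtPrime.under_maximalIdeal] at hunder
  exact hPM.ne hunder.symm

/-- An ideal with maximal radical is always primary. A nonmaximal prime radical vanishes in `A_M`
for every maximal `M` containing `I`, which forces `I` to equal its radical. -/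
theorem satisfiesStar_of_isDomain_of_ringKrullDim_eq_one {A : Type*} [CommRing A]
    (h : ∀ (M : Ideal A) [M.IsMaximal], IsDomain (Localization.AtPrime M) ∧
      ringKrullDim (Localization.AtPrime M) = 1) : SatisfiesStar A := by
  intro I hI
  by_cases hmax : I.radical.IsMaximal
  · exact Ideal.isPrimary_of_isMaximal_radical hmax
  suffices I.radical ≤ I from le_antisymm this Ideal.le_radical ▸ hI.isPrimary
  intro x hx
  by_contra hxI
  have hne : I.colon {x} ≠ ⊤ := fun htop ↦ hxI <| by
    have : (1 : A) ∈ I.colon {x} := htop ▸ Submodule.mem_top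
    simpa [Submodule.mem_colon_singleton] using this
  obtain ⟨M, hM, hle⟩ := Ideal.exists_le_maximal _ hne
  have hIM : I ≤ M := fun y hy ↦ hle <| by
    simpa [Submodule.mem_colon_singleton] using I.mul_mem_right x hy
  have hlt : I.radical < M := lt_of_le_of_ne (hM.isPrime.radical_le_iff.mpr hIM)
    fun heq ↦ hmax (heq ▸ hM)
  obtain ⟨hdom, hdim⟩ := h M
  have hx0 := algebraMap_eq_zero_of_mem_of_ringKrullDim_eq_one hdim hI hlt hx
  obtain ⟨s, hs⟩ := (IsLocalization.map_eq_zero_iff M.primeCompl _ _).mp hx0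
  refine s.2 (hle ?_)
  simp [Submodule.mem_colon_singleton, hs]

theorem ringKrullDim_eq_one_and_isReduced {A : Type*} [CommRing A] [Nontrivial A]
    (h : ∀ (M : Ideal A) [M.IsMaximal], IsDomain (Localization.AtPrime M) ∧
      ringKrullDim (Localization.AtPrime M) = 1) : ringKrullDim A = 1 ∧ IsReduced A := by
  have hheight : ∀ (M : Ideal A) [M.IsMaximal], (M.height : WithBot ℕ∞) = 1 := fun M _ ↦ by
    rw [← IsLocalization.AtPrime.ringKrullDim_eq_height M (Localization.AtPrime M), (h M).2]
  refine ⟨le_antisymm ?_ ?_, isReduced_ofLocalizationMaximal A fun M _ ↦ ?_⟩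
  · exact (ringKrullDim_le_iff_isMaximal_height_le 1).mpr fun M _ ↦ (hheight M).le
  · obtain ⟨M, hM⟩ := Ideal.exists_maximal A
    rw [← hheight M]
    exact M.height_le_ringKrullDim_of_isPrime
  · have := (h M).1
    infer_instance

theorem isVonNeumannRegular_of_polynomial [Nontrivial R] (hdim : ringKrullDim R[X] = 1)
    (hred : IsReduced R[X]) : IsVonNeumannRegular R := by
  refine ⟨isReduced_of_injective C C_injective, le_antisymm ?_ ringKrullDim_nonneg_of_nontrivial⟩
  have h := ringKrullDim_succ_le_ringKrullDim_polynomial (R := R)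
  rw [hdim] at h
  obtain ⟨n, hn⟩ := WithBot.ne_bot_iff_exists.mp
    ((WithBot.bot_lt_coe 0).trans_le (ringKrullDim_nonneg_of_nontrivial (R := R))).ne'
  rw [← hn] at h ⊢
  norm_cast at h ⊢
  exact (ENat.add_le_add_iff_right ENat.one_ne_top).mp (h.trans_eq (zero_add 1).symm)

end OneDimensional

/-! ### Condition `(*)` -/

section Star

variable {R : Type*} [CommRing R]

/-- If `R[X]` satisfies `(*)`, then a prime ideal of `R` is the only ideal with that radical. -/
theorem SatisfiesStar.eq_of_radical_eq (h : SatisfiesStar R[X]) {p J : Ideal R} (hp : p.IsPrime)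
    (hJ : J.radical = p) : J = p := by
  have hJp : J ≤ p := hJ ▸ Ideal.le_radical
  refine le_antisymm hJp fun a ha ↦ ?_
  -- Built so that `a * X ∈ I` while no power of `X` is; being primary then gives `C a ∈ I`, and
  -- constant coefficients of `I` lie in `J`.
  set I : Ideal R[X] := J.map C ⊔ Ideal.span {X} * p.map C with hI
  have hrad : I.radical = p.map C := by
    apply le_antisymm
    · rw [(isPrime_map_C p).radical_le_iff]
      exact sup_le (Ideal.map_mono hJp) Ideal.mul_le_right
    · rw [Ideal.map_le_iff_le_comap]
      intro x hx
      obtain ⟨n, hn⟩ := hJ.symm ▸ hx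
      exact ⟨n, by
        rw [← C_pow]
        exact Ideal.mem_sup_left (Ideal.mem_map_of_mem _ hn)⟩
  have hmem : C a * X ∈ I := Ideal.mem_sup_right <| by
    rw [mul_comm (C a)]
    exact Ideal.mul_mem_mul (Ideal.mem_span_singleton_self X) (Ideal.mem_map_of_mem _ ha)
  have haI := ((Ideal.isPrimary_iff.mp (h I (hrad ▸ isPrime_map_C p))).2 hmem).resolve_right
    fun hX ↦ X_notMem_map_C hp.ne_top (hrad ▸ hX)
  obtain ⟨f, hf, g, hg, hfg⟩ := Submodule.mem_sup.mp haI
  obtain ⟨g, -, rfl⟩ := Ideal.mem_span_singleton_mul.mp hg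
  have := congrArg (coeff · 0) hfg
  simp only [coeff_add, mul_coeff_zero, coeff_X_zero, coeff_C_zero, zero_mul, add_zero] at this
  exact this ▸ Ideal.mem_map_C_iff.mp hf 0

/-- If `R[X]` satisfies `(*)`, then locally at a minimal prime `p` of an ideal `K`, the ideals `K`
and `p` agree. -/
theorem SatisfiesStar.exists_mul_mem (h : SatisfiesStar R[X]) {p K : Ideal R}
    (hp : p ∈ K.minimalPrimes) {a : R} (ha : a ∈ p) : ∃ u ∉ p, u * a ∈ K := by
  have := hp.isPrime
  have hrad : ((K.map (algebraMap R (Localization.AtPrime p))).comap (algebraMap R _)).radical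
      = p := by
    rw [← Ideal.comap_radical, IsLocalization.AtPrime.radical_map_of_mem_minimalPrimes _ p K hp]
    exact IsLocalization.under_map_of_isPrime_disjoint p.primeCompl _ this
      (Set.disjoint_left.mpr fun _ hf hf' ↦ hf hf')
  rw [← h.eq_of_radical_eq this hrad, Ideal.mem_comap,
    IsLocalization.algebraMap_mem_map_algebraMap_iff p.primeCompl] at ha
  obtain ⟨u, hu, hua⟩ := ha
  exact ⟨u, hu, hua⟩

theorem SatisfiesStar.maximalIdealsVanishLocally (h : SatisfiesStar R[X]) :
    MaximalIdealsVanishLocally R := by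
  have hdim : ∀ q p : Ideal R, q.IsPrime → p.IsPrime → q ≤ p → p ≤ q := by
    intro q p hq hp hqp a hap
    by_contra haq
    -- Locally at `p'`, `a` falls in `q + (a ^ 2)`, so `a * (u - r * a) ∈ q`; this would put `u` in
    -- `p'`.
    obtain ⟨p', hp', -⟩ := Ideal.exists_minimalPrimes_le (I := q ⊔ Ideal.span {a ^ 2}) (J := p)
      (sup_le hqp <| (Ideal.span_singleton_le_iff_mem _).mpr (p.pow_mem_of_mem hap 2 two_pos))
    have hap' : a ∈ p' := hp'.isPrime.mem_of_pow_mem 2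
      (hp'.le (Ideal.mem_sup_right (Ideal.mem_span_singleton_self _)))
    obtain ⟨u, hu, hua⟩ := h.exists_mul_mem hp' hap'
    obtain ⟨y, hy, z, hz, hyz⟩ := Submodule.mem_sup.mp hua
    obtain ⟨r, rfl⟩ := Ideal.mem_span_singleton'.mp hz
    have hmem : a * (u - r * a) ∈ q := by
      convert hy using 1
      linear_combination -hyz
    have := hp'.le (Ideal.mem_sup_left ((hq.mem_or_mem hmem).resolve_left haq))
    exact hu (by simpa using p'.add_mem this (p'.mul_mem_left r hap'))
  intro p hp a ha
  obtain ⟨p', hp', hle⟩ := Ideal.exists_minimalPrimes_le (I := Ideal.span {a ^ 2}) (J := p)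
    ((Ideal.span_singleton_le_iff_mem _).mpr (p.pow_mem_of_mem ha 2 two_pos))
  obtain rfl := le_antisymm hle (hdim p' p hp'.isPrime hp.isPrime hle)
  obtain ⟨u, hu, hua⟩ := h.exists_mul_mem hp' ha
  obtain ⟨r, hr⟩ := Ideal.mem_span_singleton'.mp hua
  exact ⟨u - r * a, fun hmem ↦ hu (by
      simpa using p'.add_mem hmem (p'.mul_mem_left r ha)),
    by linear_combination -hr⟩

end Star

end AbsorbingFactorization

namespace AbsorbingFactorization

/-! ### Localizations of `R[X]` as DVRs -/

section DiscreteValuation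

variable {R : Type*} [CommRing R]

/-- With `p` the contraction of `M` to `R`, the ideal `p R[X]` is the kernel of the map to `R[X]_M`,
so generators of ideals of `R[X]_M` can be lifted from `(R ⧸ p)[X]`. -/
theorem MaximalIdealsVanishLocally.isDVR_localization (h : MaximalIdealsVanishLocally R)
    (M : Ideal R[X]) [hM : M.IsMaximal] : IsDVR (Localization.AtPrime M) := by
  set A := Localization.AtPrime M
  set p : Ideal R := M.comap C with hp
  have hpmax : p.IsMaximal := h.isMaximal_of_isPrime p (hM.isPrime.comap C)
  let := Ideal.Quotient.field p
  let φ : R[X] →+* (R ⧸ p)[X] := mapRingHom (Ideal.Quotient.mk p)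
  have hφ : Function.Surjective φ := map_surjective _ Ideal.Quotient.mk_surjective
  have hpM : p.map C ≤ M := Ideal.map_comap_le
  have hker : ∀ f : R[X], φ f = 0 ↔ f ∈ p.map C := fun f ↦ by
    rw [Ideal.mem_map_C_iff, Polynomial.ext_iff]
    simp [φ, Ideal.Quotient.eq_zero_iff_mem]
  have hzero : ∀ f : R[X], algebraMap R[X] A f = 0 ↔ φ f = 0 := by
    intro f
    rw [hker, IsLocalization.map_eq_zero_iff M.primeCompl]
    constructor
    · rintro ⟨s, hs⟩
      exact ((isPrime_map_C p).mem_or_mem (hs ▸ zero_mem _)).resolve_left fun hs' ↦ s.2 (hpM hs')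
    · intro hf
      obtain ⟨u, hu, huf⟩ := h.exists_C_mul_eq_zero hpmax hf
      exact ⟨⟨C u, hu⟩, huf⟩
  have hdom : IsDomain A := by
    have : NoZeroDivisors A := ⟨by
      intro x y hxy
      obtain ⟨f, s, rfl⟩ := IsLocalization.exists_mk'_eq M.primeCompl x
      obtain ⟨g, t, rfl⟩ := IsLocalization.exists_mk'_eq M.primeCompl y
      rw [← IsLocalization.mk'_mul, IsLocalization.mk'_eq_zero_iff] at hxy
      obtain ⟨r, hr⟩ := hxy
      have : algebraMap R[X] A (f * g) = 0 :=
        (IsLocalization.map_eq_zero_iff M.primeCompl _ _).mpr ⟨r, hr⟩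
      rw [hzero, map_mul, mul_eq_zero, ← hzero, ← hzero] at this
      exact this.imp (fun h ↦ by rw [IsLocalization.mk'_eq_mul_mk'_one, h, zero_mul])
        (fun h ↦ by rw [IsLocalization.mk'_eq_mul_mk'_one, h, zero_mul])⟩
    exact NoZeroDivisors.to_isDomain A
  have hpid : IsPrincipalIdealRing A := by
    refine ⟨fun I ↦ ?_⟩
    obtain ⟨d, hd⟩ := IsPrincipalIdealRing.principal ((I.comap (algebraMap R[X] A)).map φ)
    have hdmem : d ∈ (I.comap (algebraMap R[X] A)).map φ :=
      hd ▸ Ideal.mem_span_singleton_self d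
    obtain ⟨f, hf, rfl⟩ := (Ideal.mem_map_iff_of_surjective φ hφ).mp hdmem
    refine ⟨algebraMap R[X] A f, le_antisymm ?_ ?_⟩
    · rw [← IsLocalization.map_under M.primeCompl A I, Ideal.map_le_iff_le_comap]
      intro g hg
      have hgmem : φ g ∈ (I.comap (algebraMap R[X] A)).map φ := Ideal.mem_map_of_mem φ hg
      rw [hd] at hgmem
      obtain ⟨q, hq⟩ := Ideal.mem_span_singleton'.mp hgmem
      obtain ⟨q, rfl⟩ := hφ q
      rw [← map_mul, ← sub_eq_zero, ← map_sub, ← hzero, map_sub, map_mul, sub_eq_zero] at hq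
      exact Ideal.mem_span_singleton'.mpr ⟨_, hq⟩
    · exact (Ideal.span_singleton_le_iff_mem _).mpr hf
  refine ⟨hdom, { toIsPrincipalIdealRing := hpid, not_a_field' := fun hbot ↦ ?_ }⟩
  -- If `A` were a field, `M` would be the kernel of `φ`, making `(R ⧸ p)[X]` a field.
  have hMp : M ≤ p.map C := fun f hf ↦ by
    have : algebraMap R[X] A f ∈ IsLocalRing.maximalIdeal A := by
      rw [← Localization.AtPrime.map_eq_maximalIdeal]
      exact Ideal.mem_map_of_mem _ hf
    rwa [hbot, Ideal.mem_bot, hzero, hker] at this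
  have hkerM : RingHom.ker φ = M :=
    Ideal.ext fun f ↦ ⟨fun hf ↦ hpM ((hker f).mp hf), fun hf ↦ (hker f).mpr (hMp hf)⟩
  have hfield : IsField (R ⧸ p)[X] :=
    (RingHom.quotientKerEquivOfSurjective hφ).symm.toMulEquiv.isField
      ((Ideal.Quotient.maximal_ideal_iff_isField_quotient _).mp (hkerM ▸ hM))
  exact Polynomial.not_isField _ hfield

end DiscreteValuation

/-! ### From DVR to PVD, PVR, divided and TAF -/

section Valuation

variable {A : Type*} [CommRing A]

theorem IsDVR.isMori (h : IsDVR A) : IsMori A := by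
  obtain ⟨_, _⟩ := h
  exact ⟨inferInstance, fun f _ ↦ monotone_stabilizes_iff_noetherian.mpr inferInstance f⟩

/-- If `x ∉ A` then `x⁻¹ ∈ A`, so `y = x⁻¹ * (x * y)` stays in `P`; inside `A` this is ordinary
primality. -/
theorem IsDVR.isPVD (h : IsDVR A) : IsPVD A := by
  obtain ⟨_, _⟩ := h
  refine ⟨inferInstance, fun P hP ↦ ?_⟩
  have key : ∀ x y : FractionRing A, x * y ∈ IsLocalization.coeSubmodule (FractionRing A) P →
      IsLocalization.IsInteger A x⁻¹ → x ≠ 0 → y ∈ IsLocalization.coeSubmodule (FractionRing A) P := by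
    rintro x y hxy ⟨z, hz⟩ hx
    have := Submodule.smul_mem _ z hxy
    rwa [Algebra.smul_def, hz, inv_mul_cancel_left₀ hx] at this
  intro x y hxy
  rcases eq_or_ne x 0 with rfl | hx
  · exact Or.inl (zero_mem _)
  rcases eq_or_ne y 0 with rfl | hy
  · exact Or.inr (zero_mem _)
  rcases ValuationRing.isInteger_or_isInteger A x with ⟨a, rfl⟩ | hx'
  · rcases ValuationRing.isInteger_or_isInteger A y with ⟨b, rfl⟩ | hy'
    · obtain ⟨c, hc, hcab⟩ := (IsLocalization.mem_coeSubmodule _ _).mp hxy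
      rw [← map_mul] at hcab
      rw [IsFractionRing.injective A (FractionRing A) hcab] at hc
      exact (hP.mem_or_mem hc).imp (fun h ↦ (IsLocalization.mem_coeSubmodule _ _).mpr ⟨a, h, rfl⟩)
        (fun h ↦ (IsLocalization.mem_coeSubmodule _ _).mpr ⟨b, h, rfl⟩)
    · exact Or.inl (key y _ (mul_comm y _ ▸ hxy) hy' hy)
  · exact Or.inr (key x y hxy hx' hx)

/-- If `a * m ∉ (b)`, apply strong primality to `(b / a) * (a * m / b) = m`: the second factor is
not in `A`, so `b / a` is in the maximal ideal. -/
theorem IsPVD.isPVR [IsLocalRing A] (h : IsPVD A) : IsPVR A := by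
  obtain ⟨_, h⟩ := h
  have hinj := IsFractionRing.injective A (FractionRing A)
  refine ⟨IsLocalRing.maximalIdeal A, inferInstance, inferInstance, fun a b ↦ ?_⟩
  rw [or_iff_not_imp_left]
  intro hab
  obtain ⟨c, hc, hcb⟩ := SetLike.not_le_iff_exists.mp hab
  obtain ⟨m, hm, rfl⟩ := Ideal.mem_span_singleton_mul.mp hc
  have ha : algebraMap A (FractionRing A) a ≠ 0 := fun ha ↦ hcb <| by
    rw [(map_eq_zero_iff _ hinj).mp ha, zero_mul]
    exact zero_mem _
  rcases eq_or_ne b 0 with rfl | hb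
  · exact (Ideal.span_singleton_le_iff_mem _).mpr (zero_mem _)
  have hb : algebraMap A (FractionRing A) b ≠ 0 := fun hb' ↦ hb ((map_eq_zero_iff _ hinj).mp hb')
  have hprod : algebraMap A (FractionRing A) b / algebraMap A _ a *
      (algebraMap A _ a * algebraMap A _ m / algebraMap A _ b) ∈
        IsLocalization.coeSubmodule (FractionRing A) (IsLocalRing.maximalIdeal A) :=
    (IsLocalization.mem_coeSubmodule _ _).mpr ⟨m, hm, by field_simp⟩
  rw [Ideal.span_singleton_le_iff_mem, Ideal.mem_span_singleton_mul]
  rcases h _ inferInstance _ _ hprod with h | h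
  · obtain ⟨z, hz, hzx⟩ := (IsLocalization.mem_coeSubmodule _ _).mp h
    refine ⟨z, hz, hinj ?_⟩
    rw [map_mul, hzx]
    field_simp
  · obtain ⟨z, hz, hzx⟩ := (IsLocalization.mem_coeSubmodule _ _).mp h
    refine absurd (Ideal.mem_span_singleton'.mpr ⟨z, hinj ?_⟩) hcb
    rw [map_mul, map_mul, hzx]
    field_simp

/-- For `b ∈ P` and a nonunit `a ∉ P`, having `aM ⊆ bA` would give `a * a ∈ P`; hence `bA ⊆ aM`. -/
theorem IsPVR.isDivided [IsLocalRing A] (h : IsPVR A) : IsDivided A := by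
  obtain ⟨N, hN, -, hcomp⟩ := h
  obtain rfl := IsLocalRing.eq_maximalIdeal hN
  intro P hP a ha
  refine lt_of_le_of_ne (fun b hb ↦ ?_) fun heq ↦ ha (heq ▸ Ideal.mem_span_singleton_self a)
  by_cases hau : IsUnit a
  · rw [Ideal.span_singleton_eq_top.mpr hau]
    trivial
  rcases hcomp a b with hle | hle
  · have hmem : a * a ∈ P := (Ideal.span_singleton_le_iff_mem _).mpr hb <|
      (hle (Ideal.mem_span_singleton_mul.mpr ⟨a, (IsLocalRing.mem_maximalIdeal a).mpr hau, rfl⟩))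
    exact absurd ((or_self_iff).mp (hP.mem_or_mem hmem)) ha
  · exact Ideal.mul_le_left (hle (Ideal.mem_span_singleton_self b))

theorem isNAbsorbing_two_of_isPrime {P : Ideal A} (hP : P.IsPrime) : IsNAbsorbing 2 P := by
  refine ⟨hP.ne_top, fun a ha ↦ ?_⟩
  obtain ⟨i, -, hi⟩ := hP.prod_mem_iff.mp ha
  obtain ⟨j, hj⟩ := exists_ne i
  exact ⟨j, hP.prod_mem_iff.mpr ⟨i, Finset.mem_erase.mpr ⟨hj.symm, Finset.mem_univ i⟩, hi⟩⟩

theorem IsDVR.isTAFRing (h : IsDVR A) : IsTAFRing A := by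
  obtain ⟨_, _⟩ := h
  intro I _
  rcases eq_or_ne I ⊥ with rfl | hI
  · exact ⟨{⊥}, by simpa using isNAbsorbing_two_of_isPrime Ideal.isPrime_bot,
      Multiset.prod_singleton _⟩
  · obtain ⟨ϖ, hϖ⟩ := IsDiscreteValuationRing.exists_irreducible A
    obtain ⟨n, rfl⟩ := IsDiscreteValuationRing.ideal_eq_span_pow_irreducible hI hϖ
    refine ⟨Multiset.replicate n (Ideal.span {ϖ}), fun J hJ ↦ ?_, ?_⟩
    · rw [Multiset.eq_of_mem_replicate hJ]
      exact isNAbsorbing_two_of_isPrime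
        ((Ideal.span_singleton_prime hϖ.ne_zero).mpr hϖ.prime)
    · rw [Multiset.prod_replicate, Ideal.span_singleton_pow]

end Valuation

end AbsorbingFactorization

namespace AbsorbingFactorization

/-! ### Absorbing factorizations -/

section Factorization

/-- If, in a local ring, `w` is regular modulo `c` and `(c, w)` is a product of two proper ideals,
then `(c, w)` is principal. -/
theorem exists_span_pair_eq_span_singleton_of_eq_mul {A : Type*} [CommRing A] [IsLocalRing A]
    {c w : A} {J K : Ideal A} (hJ : J ≠ ⊤) (hK : K ≠ ⊤) (hJK : Ideal.span {c, w} = J * K)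
    (hreg : ∀ y, c ∣ w * y → c ∣ y) : ∃ h, Ideal.span {c, w} = Ideal.span {h} := by
  have hJm := IsLocalRing.le_maximalIdeal hJ
  have hKm := IsLocalRing.le_maximalIdeal hK
  have hc : c ∈ J * K := hJK ▸ Ideal.subset_span (by simp)
  have hw : w ∈ J * K := hJK ▸ Ideal.subset_span (by simp)
  have hcu : ¬ IsUnit c := hJm (Ideal.mul_le_left hc)
  have hmem : ∀ {x}, x ∈ J * K → ∃ d e, d * w + c * e = x := fun hx ↦ by
    rw [← hJK] at hx
    obtain ⟨e, d, rfl⟩ := Ideal.mem_span_pair.mp hx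
    exact ⟨d, e, by ring⟩
  -- Otherwise every element of `J * K`, including `w`, has a `w`-coefficient in the maximal ideal,
  -- and regularity makes `c` a unit.
  obtain ⟨f, hf, g, hg, d, e, hd, hfg⟩ :
      ∃ f ∈ J, ∃ g ∈ K, ∃ d e, IsUnit d ∧ d * w + c * e = f * g := by
    by_contra! hcon
    have hall : ∀ x ∈ J * K, ∃ d ∈ IsLocalRing.maximalIdeal A, ∃ e, d * w + c * e = x := by
      intro x hx
      induction hx using Submodule.mul_induction_on' with
      | mem_mul_mem m hm n hn =>
        obtain ⟨d, e, hde⟩ := hmem (Ideal.mul_mem_mul hm hn)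
        exact ⟨d, fun hd ↦ hcon m hm n hn d e hd hde, e, hde⟩
      | add x _ y _ hx hy =>
        obtain ⟨d, hd, e, rfl⟩ := hx
        obtain ⟨d', hd', e', rfl⟩ := hy
        exact ⟨d + d', add_mem hd hd', e + e', by ring⟩
    obtain ⟨d, hd, e, hde⟩ := hall w hw
    have hdvd : c ∣ 1 - d := hreg _ ⟨e, by linear_combination -hde⟩
    have hunit : IsUnit (1 - d) :=
      (IsLocalRing.isUnit_or_isUnit_one_sub_self d).resolve_left hd
    exact hcu (isUnit_of_dvd_unit hdvd hunit)
  obtain ⟨d', hd'⟩ := hd.exists_left_inv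
  have hregfg : ∀ y, c ∣ f * g * y → c ∣ y := fun y ⟨z, hz⟩ ↦
    hreg y ⟨d' * (z - e * y), by linear_combination -w * y * hd' + d' * y * hfg + d' * hz⟩
  -- Modulo `c`, `j * g` is a multiple of `w`, hence of `f * g`; multiply by `f` and cancel the
  -- regular `f * g`.
  have hJgen : ∀ j ∈ J, ∃ α t, j = α * f + c * t := by
    intro j hj
    obtain ⟨α, β, hαβ⟩ := hmem (Ideal.mul_mem_mul hj hg)
    obtain ⟨t, ht⟩ := hregfg (j - d' * α * f) ⟨f * β - α * d' * e * f, by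
      linear_combination -f * hαβ - f * α * w * hd' + f * d' * α * hfg⟩
    exact ⟨d' * α, t, by linear_combination ht⟩
  have hKgen : ∀ k ∈ K, ∃ α t, k = α * g + c * t := by
    intro k hk
    obtain ⟨α, β, hαβ⟩ := hmem (Ideal.mul_mem_mul hf hk)
    obtain ⟨t, ht⟩ := hregfg (k - d' * α * g) ⟨g * β - α * d' * e * g, by
      linear_combination -g * hαβ - g * α * w * hd' + g * d' * α * hfg⟩
    exact ⟨d' * α, t, by linear_combination ht⟩
  -- The cross terms are `c` times elements of the maximal ideal, so Nakayama applies.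
  have hle : J * K ≤ Ideal.span {f * g} ⊔ IsLocalRing.maximalIdeal A • (J * K) := by
    rw [Ideal.mul_le]
    intro j hj k hk
    obtain ⟨α, t, rfl⟩ := hJgen j hj
    obtain ⟨β, t', rfl⟩ := hKgen k hk
    have : (α * f + c * t) * (β * g + c * t') =
        α * β * (f * g) + (α * f * t' + t * (β * g + c * t')) * c := by ring
    rw [this]
    refine add_mem (Ideal.mem_sup_left (Ideal.mul_mem_left _ _ (Ideal.mem_span_singleton_self _)))
      (Ideal.mem_sup_right (Submodule.smul_mem_smul ?_ hc))
    exact add_mem (Ideal.mul_mem_right _ _ (Ideal.mul_mem_left _ _ (hJm hf)))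
      (Ideal.mul_mem_left _ _ (hKm hk))
  have hfinal : J * K ≤ Ideal.span {f * g} :=
    Submodule.le_of_le_smul_of_le_jacobson_bot (hJK ▸ Submodule.fg_span (Set.toFinite _))
      (IsLocalRing.jacobson_eq_maximalIdeal ⊥ bot_ne_top).ge hle
  exact ⟨f * g, hJK.trans <| le_antisymm hfinal <|
    (Ideal.span_singleton_le_iff_mem _).mpr (Ideal.mul_mem_mul hf hg)⟩

variable {R : Type*} [CommRing R]

/-- Multiplication by `X ^ N` only shifts coefficients, so it is regular modulo `c`, and
localization preserves this. -/
theorem C_dvd_of_C_dvd_X_pow_mul (M : Ideal R[X]) [M.IsPrime] (c : R) (N : ℕ)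
    (y : Localization.AtPrime M)
    (h : algebraMap R[X] (Localization.AtPrime M) (C c) ∣ algebraMap R[X] _ (X ^ N) * y) :
    algebraMap R[X] (Localization.AtPrime M) (C c) ∣ y := by
  obtain ⟨z, hz⟩ := h
  obtain ⟨⟨f, s⟩, hf⟩ := IsLocalization.surj M.primeCompl y
  obtain ⟨⟨g, t⟩, hg⟩ := IsLocalization.surj M.primeCompl z
  simp only at hf hg
  have heq : algebraMap R[X] (Localization.AtPrime M) (X ^ N * f * (t : R[X])) =
      algebraMap R[X] _ (C c * g * (s : R[X])) := by
    simp only [map_mul, ← hf, ← hg] at hz ⊢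
    linear_combination algebraMap R[X] (Localization.AtPrime M) s *
      algebraMap R[X] (Localization.AtPrime M) t * hz
  obtain ⟨r, hr⟩ := (IsLocalization.eq_iff_exists M.primeCompl _).mp heq
  have hdvd : C c ∣ (r : R[X]) * t * f := by
    rw [C_dvd_iff_dvd_coeff]
    intro i
    rw [← coeff_X_pow_mul _ N]
    refine (C_dvd_iff_dvd_coeff _ _).mp ⟨(r : R[X]) * g * (s : R[X]), ?_⟩ _
    linear_combination hr
  have hmap := map_dvd (algebraMap R[X] (Localization.AtPrime M)) hdvd
  rw [map_mul, map_mul, ← hf] at hmap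
  have hunit : ∀ u : M.primeCompl, IsUnit (algebraMap R[X] (Localization.AtPrime M) u) :=
    IsLocalization.map_units _
  rwa [((hunit r).mul (hunit t)).dvd_mul_left, (hunit s).dvd_mul_right] at hmap

theorem maximalIdealsVanishLocally_of_isFAFRing
    (h : ∀ (M : Ideal R[X]) [M.IsMaximal], IsFAFRing (Localization.AtPrime M)) :
    MaximalIdealsVanishLocally R := by
  intro p hp c hc
  refine exists_mul_eq_zero_of_X_dvd (p := p) ?_
  obtain ⟨n, -, hfac⟩ := h (originIdeal p)
  set A := Localization.AtPrime (originIdeal p)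
  have hXm : algebraMap R[X] A X ∈ IsLocalRing.maximalIdeal A := by
    rw [← Localization.AtPrime.map_eq_maximalIdeal]
    exact Ideal.mem_map_of_mem _ (X_mem_originIdeal p)
  have hXpow : ∀ k, algebraMap R[X] A (X ^ k) ∉ extendedPrime p := fun k hk ↦
    X_notMem_extendedPrime p (Ideal.IsPrime.mem_of_pow_mem inferInstance k (by rwa [← map_pow]))
  have hcP : algebraMap R[X] A (C c) ∈ extendedPrime p := C_mem_extendedPrime hc
  have hproper : Ideal.span {algebraMap R[X] A (C c), algebraMap R[X] A (X ^ (n + 1))} ≠ ⊤ := by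
    refine ne_top_of_le_ne_top (IsLocalRing.maximalIdeal.isMaximal A).ne_top (Ideal.span_le.mpr ?_)
    rw [Set.insert_subset_iff, Set.singleton_subset_iff, map_pow]
    exact ⟨IsLocalRing.le_maximalIdeal Ideal.IsPrime.ne_top' hcP,
      Ideal.pow_mem_of_mem _ hXm _ n.succ_pos⟩
  obtain ⟨s, hs, hprod⟩ := hfac _ hproper
  induction s using Multiset.induction_on with
  | empty => exact absurd (hprod.symm.trans (Multiset.prod_zero.trans Ideal.one_eq_top)) hproper
  | cons J s _ =>
    rw [Multiset.prod_cons] at hprod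
    have hJ := hs J (Multiset.mem_cons_self J s)
    induction s using Multiset.induction_on with
    | empty =>
      rw [Multiset.prod_zero, mul_one] at hprod
      -- A single `n`-absorbing factor would contain `X ^ n`; since `1 - β * X` is a unit, `X ^ n`
      -- would lie in the extended prime.
      obtain ⟨i, hi⟩ := hJ.2 (fun _ ↦ algebraMap R[X] A X) (by
        rw [Finset.prod_const, Finset.card_univ, Fintype.card_fin, ← map_pow, hprod]
        exact Ideal.subset_span (by simp))
      rw [Finset.prod_const, Finset.card_erase_of_mem (Finset.mem_univ i), Finset.card_univ,
        Fintype.card_fin, Nat.add_sub_cancel, hprod] at hi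
      obtain ⟨α, β, hαβ⟩ := Ideal.mem_span_pair.mp hi
      have hunit : IsUnit (1 - β * algebraMap R[X] A X) :=
        (IsLocalRing.isUnit_or_isUnit_one_sub_self _).resolve_left
          (Ideal.mul_mem_left _ β hXm)
      have hmem : algebraMap R[X] A X ^ n * (1 - β * algebraMap R[X] A X) ∈ extendedPrime p := by
        convert Ideal.mul_mem_left _ α hcP using 1
        rw [map_pow] at hαβ
        linear_combination -hαβ
      rw [Ideal.mul_unit_mem_iff_mem _ hunit, ← map_pow] at hmem
      exact absurd hmem (hXpow n)
    | cons K s _ =>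
      have hK := hs K (by simp)
      have hKtop : (K ::ₘ s).prod ≠ ⊤ := ne_top_of_le_ne_top hK.1 <| by
        rw [Multiset.prod_cons]
        exact Ideal.mul_le_left
      obtain ⟨d, hd⟩ := exists_span_pair_eq_span_singleton_of_eq_mul hJ.1 hKtop hprod.symm
        (C_dvd_of_C_dvd_X_pow_mul _ c (n + 1))
      rcases dvd_or_dvd_of_span_pair_eq hd with hdvd | hdvd
      · exact absurd (Ideal.mem_of_dvd _ hdvd hcP) (hXpow (n + 1))
      · refine dvd_trans ?_ hdvd
        rw [map_pow]
        exact dvd_pow_self _ n.succ_ne_zero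

end Factorization

end AbsorbingFactorization

theorem theorem5p6 (R : Type*) [CommRing R] [Nontrivial R] :
    List.TFAE [
      AbsorbingFactorization.IsVonNeumannRegular R,
      IsBezout R[X],
      AbsorbingFactorization.IsArithmetical R[X],
      AbsorbingFactorization.SatisfiesStar R[X],
      ∀ (M : Ideal R[X]) [M.IsMaximal],
        AbsorbingFactorization.IsDVR (Localization.AtPrime M),
      ∀ (M : Ideal R[X]) [M.IsMaximal],
        AbsorbingFactorization.IsMori (Localization.AtPrime M) ∧
          AbsorbingFactorization.IsPVD (Localization.AtPrime M),
      ∀ (M : Ideal R[X]) [M.IsMaximal],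
        AbsorbingFactorization.IsPVD (Localization.AtPrime M),
      AbsorbingFactorization.IsLPVR R[X],
      ∀ (M : Ideal R[X]) [M.IsMaximal],
        IsDomain (Localization.AtPrime M) ∧
          AbsorbingFactorization.IsTAFRing (Localization.AtPrime M),
      ∀ (M : Ideal R[X]) [M.IsMaximal],
        AbsorbingFactorization.IsTAFRing (Localization.AtPrime M),
      ∀ (M : Ideal R[X]) [M.IsMaximal],
        AbsorbingFactorization.IsFAFRing (Localization.AtPrime M),
      ∀ (M : Ideal R[X]) [M.IsMaximal],
        IsDomain (Localization.AtPrime M) ∧ ringKrullDim (Localization.AtPrime M) = 1,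
      AbsorbingFactorization.IsLocallyDivided R[X],
      ringKrullDim R[X] = 1 ∧ IsReduced R[X]] := by
  tfae_have 1 → 2 := fun h ↦ h.maximalIdealsVanishLocally.isBezout_polynomial
  tfae_have 2 → 3 := fun _ ↦ AbsorbingFactorization.isArithmetical_of_isBezout R[X]
  tfae_have 3 → 1 := fun h ↦
    (AbsorbingFactorization.maximalIdealsVanishLocally_of_isArithmetical h).isVonNeumannRegular
  tfae_have 1 → 5 := fun h M _ ↦ h.maximalIdealsVanishLocally.isDVR_localization M
  tfae_have 5 → 6 := fun h M _ ↦ ⟨(h M).isMori, (h M).isPVD⟩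
  tfae_have 6 → 7 := fun h M _ ↦ (h M).2
  tfae_have 7 → 8 := fun h M _ ↦ (h M).isPVR
  tfae_have 8 → 13 := fun h M _ ↦ (h M).isDivided
  tfae_have 13 → 1 := fun h ↦
    (AbsorbingFactorization.maximalIdealsVanishLocally_of_isLocallyDivided h).isVonNeumannRegular
  tfae_have 5 → 9 := fun h M _ ↦ ⟨(h M).choose, (h M).isTAFRing⟩
  tfae_have 9 → 10 := fun h M _ ↦ (h M).2
  tfae_have 10 → 11 := fun h M _ ↦ ⟨2, one_le_two, h M⟩
  tfae_have 11 → 1 := fun h ↦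
    (AbsorbingFactorization.maximalIdealsVanishLocally_of_isFAFRing h).isVonNeumannRegular
  tfae_have 5 → 12 := fun h M _ ↦ by
    obtain ⟨_, _⟩ := h M
    exact ⟨inferInstance, IsDiscreteValuationRing.ringKrullDim_eq_one _⟩
  tfae_have 12 → 4 := AbsorbingFactorization.satisfiesStar_of_isDomain_of_ringKrullDim_eq_one
  tfae_have 4 → 1 := fun h ↦ h.maximalIdealsVanishLocally.isVonNeumannRegular
  tfae_have 12 → 14 := AbsorbingFactorization.ringKrullDim_eq_one_and_isReduced
  tfae_have 14 → 1 := fun h ↦ AbsorbingFactorization.isVonNeumannRegular_of_polynomial h.1 h.2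
  tfae_finish
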